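/- Let $n\ge 2$. A bounded domain (nonempty, open, connected set) $\Omega\subset\mathbb R^n$ is an $s$-distance John domain ($s\ge 1$) with John constant $C_J\ge 1$ if there is a point $x_J\in\Omega$ such that every $x\in\Omega$ can be joined to $x_J$ by a rectifiable curve $c:[0,1]\to\Omega$, $c(0)=x$, $c(1)=x_J$, with $$C_J\,\operatorname{dist}(c(t),\partial\Omega)>|c(t)-x|^{s}\qquad\text{for all } t\in[0,1].$$ For $\delta,\tau\in(0,1)$ and a Lebesgue measurable set $U\subset\Omega$ put $$\mathcal P_{\delta,\tau}(U,\Omega)=\int_\Omega\int_{|x-y|<\tau\operatorname{dist}(y,\partial\Omega)}\frac{|\chi_U(x)-\chi_U(y)|}{|x-y|^{n+\delta}}\,dx\,dy\in[0,\infty].$$ **Theorem (geometric Boxing inequality).** Let $\delta,\tau,\gamma\in(0,1)$ and let $\Omega\subset\mathbb R^n$ be an $s$-distance John domain with John constant $C_J$, where $1\le s\le \frac{n}{n-\delta}$. Then there is a constant $C>0$, depending only on $n,\tau,s,\gamma,C_J$ and $\operatorname{diam}\Omega$ (in particular not on $\delta$), such that for every Lebesgue measurable set $U\subset\Omega$ with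 $|U|/|\Omega|\le\gamma$ there are a set $\mathcal N_U$ of Lebesgue measure zero and balls $B(x_i,r_i)$, $i=1,2,\dots$, with $r_i\ge 0$ (where $B(x,0)=\emptyset$, so that the family may be finite or empty), such that $$U\setminus\mathcal N_U\subset\bigcup_{i=1}^\infty B(x_i,r_i)\qquad\text{and}\qquad \sum_{i=1}^{\infty} r_i^{s(n-\delta)}\le C(1-\delta)\,\mathcal P_{\delta,\tau}(U,\Omega).$$ If $U$ is open, one can take $\mathcal N_U=\emptyset$. -/

import Mathlib

open MeasureTheory Set
open scoped ENNReal

/-- `Ω ⊂ ℝⁿ` is an `s`-distance John domain with John constant `CJ`: a bounded nonempty open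
connected set with a distinguished point `xJ` (the John center) such that every `x ∈ Ω` can be
joined to `xJ` inside `Ω` by a rectifiable curve `c : [0,1] → Ω` (continuous, of finite length)
along which `CJ * dist (c t, ∂Ω) > |c t - x| ^ s`. -/
structure IsDistanceJohnDomain {n : ℕ} (s CJ : ℝ) (Ω : Set (EuclideanSpace ℝ (Fin n))) :
    Prop where
  isOpen : IsOpen Ω
  isConnected : IsConnected Ω
  isBounded : Bornology.IsBounded Ω
  exists_center : ∃ xJ ∈ Ω, ∀ x ∈ Ω, ∃ c : ℝ → EuclideanSpace ℝ (Fin n),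
    ContinuousOn c (Icc 0 1) ∧ BoundedVariationOn c (Icc 0 1) ∧
    MapsTo c (Icc 0 1) Ω ∧ c 0 = x ∧ c 1 = xJ ∧
    ∀ t ∈ Icc (0 : ℝ) 1, dist (c t) x ^ s < CJ * Metric.infDist (c t) (frontier Ω)

/-- The improved relative fractional perimeter
`P_{δ,τ}(U, Ω) = ∫_Ω ∫_{|x-y| < τ dist(y,∂Ω)} |χ_U(x) - χ_U(y)| / |x-y|^{n+δ} dx dy`,
with values in `[0, ∞]`. -/
noncomputable def improvedPerimeter {n : ℕ} (δ τ : ℝ) (U Ω : Set (EuclideanSpace ℝ (Fin n))) :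
    ℝ≥0∞ :=
  ∫⁻ y in Ω, ∫⁻ x in {x | dist x y < τ * Metric.infDist y (frontier Ω)},
    ENNReal.ofReal
      (|U.indicator (fun _ => (1 : ℝ)) x - U.indicator (fun _ => (1 : ℝ)) y| /
        dist x y ^ ((n : ℝ) + δ))

/-!
The proof rests on two facts: a set that fills exactly half of a ball has large fractional energy
in that ball, and on a John domain every density point of `U` lies near such a ball.

*Energy of half-filled balls.* Let `E(t)` be the integral of `|χ_U x - χ_U y|` over the pairs of
points of a convex set `B` at distance less than `t`. Comparing `x` and `y` with their midpoint
gives `E(t) ≤ 2 ^ (n + 1) E(t / 2)` (`pairEnergy_le_half`). The kernel `|x - y| ^ (-(n + δ))`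
dominates the sum of `(t / 2 ^ k) ^ (-(n + δ))` over the dyadic scales exceeding `|x - y|`, so the
fractional energy of `B` is at least `t ^ (-(n + δ)) E(t)` times a geometric series of ratio
`2 ^ (δ - 1)`, whose sum is at least `1 / (1 - δ)` (`pairEnergy_le_gagliardoEnergy`). If `B` is a
ball of radius `ρ` and `U` fills half of it, then `E(2 ρ)` is comparable to `ρ ^ (2 n)`, whence
`ρ ^ (n - δ)` is at most a constant times `1 - δ` times the energy
(`rpow_le_gagliardoEnergy_of_half`).

*Finding half-filled balls.* Suppose that `U` fills at most half of the Whitney ball at the John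
center, where the Whitney ball at `z` has radius `τ / 4` times the distance of `z` to the boundary.
For a density point `x` of `U`, the balls shrinking to `x` are eventually filled by more than half.
Since the measure of `U ∩ B(z, ρ)` is continuous in `(z, ρ)`, the intermediate value theorem
applied to small balls at `x` and then to the Whitney balls along the John curve yields a ball
`B(z, ρ)` filled exactly by half (`exists_half_ball`), and the John condition gives
`|z - x| ^ s < K ρ`. Vitali's covering lemma for the balls `B(z, (K ρ) ^ (1 / s))` provides the
covering: the `s (n - δ)`-th powers of their radii are comparable to `ρ ^ (n - δ)`, and the energies
in the disjoint balls `B(z, ρ)` add up to at most the improved perimeter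
(`exists_covering_of_central_le_half`).

*Large sets.* If `U` fills more than half of the central ball, the same covering exists for `Ω \ U`,
whose measure is bounded below because `|U| ≤ γ |Ω|`. As `s (n - δ) ≤ n` and the radii are bounded,
the sum of the powers of the radii is bounded below by a multiple of `|Ω \ U|`. So the perimeter is
bounded below, and one ball containing `Ω` covers `U` (`two_mul_diam_rpow_le`).
-/

/-! ### Dyadic sums -/

/-- A geometric sum is controlled by its last term: summing `(t / 2 ^ k) ^ (-p)` over the dyadic
scales above `ρ` gives at most `2 ρ ^ (-p)`. The subtracted `t ^ (-p)` makes room for the next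
larger scale in the induction. -/
lemma sum_dyadic_rpow_le {p : ℝ} (hp : 1 ≤ p) {ρ : ℝ} (hρ : 0 < ρ) (N : ℕ) :
    ∀ t : ℝ, 0 < t →
    ∑ k ∈ Finset.range N, (if ρ < t / 2 ^ k then (t / 2 ^ k) ^ (-p) else 0) ≤
      if ρ < t then 2 * ρ ^ (-p) - t ^ (-p) else 0 := by
  induction N with
  | zero =>
    intro t ht
    simp only [Finset.range_zero, Finset.sum_empty]
    split_ifs with h
    · have := Real.rpow_le_rpow_of_nonpos hρ h.le (by linarith : -p ≤ 0)
      have := Real.rpow_nonneg hρ.le (-p)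
      linarith
    · exact le_rfl
  | succ N ih =>
    intro t ht
    rw [Finset.sum_range_succ']
    have h2 := ih (t / 2) (by positivity)
    simp only [div_div, ← pow_succ'] at h2
    simp only [pow_zero, div_one]
    have e : (t / 2) ^ (-p) = 2 ^ p * t ^ (-p) := by
      rw [Real.div_rpow ht.le (by norm_num), Real.rpow_neg (by norm_num : (0:ℝ) ≤ 2)]
      field_simp
    have h2p : (2:ℝ) ≤ 2 ^ p := by
      simpa using Real.rpow_le_rpow_of_exponent_le (by norm_num : (1:ℝ) ≤ 2) hp
    have htp : 0 < t ^ (-p) := Real.rpow_pos_of_pos ht _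
    by_cases h : ρ < t
    · rw [if_pos h, if_pos h]
      by_cases h' : ρ < t / 2
      · rw [if_pos h', e] at h2
        nlinarith
      · rw [if_neg h'] at h2
        have := Real.rpow_le_rpow_of_nonpos hρ h.le (by linarith : -p ≤ 0)
        linarith
    · rw [if_neg h, if_neg h]
      rw [if_neg (by linarith)] at h2
      linarith

lemma tsum_dyadic_ofReal_rpow_le {p : ℝ} (hp : 1 ≤ p) {ρ t : ℝ} (hρ : 0 < ρ) (ht : 0 < t) :
    ∑' k : ℕ, (if ρ < t / 2 ^ k then ENNReal.ofReal ((t / 2 ^ k) ^ (-p)) else 0) ≤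
      ENNReal.ofReal (2 * ρ ^ (-p)) := by
  refine ENNReal.tsum_le_of_sum_range_le fun N => ?_
  calc _ = ENNReal.ofReal (∑ k ∈ Finset.range N,
        (if ρ < t / 2 ^ k then (t / 2 ^ k) ^ (-p) else 0)) := by
        rw [ENNReal.ofReal_sum_of_nonneg]
        · refine Finset.sum_congr rfl fun k _ => ?_
          split_ifs <;> simp
        · intro k _
          split_ifs <;> positivity
    _ ≤ _ := by
        refine ENNReal.ofReal_le_ofReal ((sum_dyadic_rpow_le hp hρ N t ht).trans ?_)
        have := Real.rpow_nonneg hρ.le (-p)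
        have := Real.rpow_nonneg ht.le (-p)
        split_ifs <;> linarith

lemma one_le_mul_tsum_geometric {a : ℝ} (ha : 0 < a) :
    1 ≤ ENNReal.ofReal a * ∑' k : ℕ, ENNReal.ofReal (2 ^ (-a)) ^ k := by
  have h1 : (2 : ℝ) ^ (-a) < 1 := Real.rpow_lt_one_of_one_lt_of_neg (by norm_num) (by linarith)
  have h0 : (0:ℝ) < 2 ^ (-a) := by positivity
  have h2 : 1 - (2 : ℝ) ^ (-a) ≤ a := by
    rw [Real.rpow_def_of_pos (by norm_num)]
    have := Real.add_one_le_exp (Real.log 2 * -a)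
    have := Real.log_two_lt_d9
    nlinarith
  rw [ENNReal.tsum_geometric, ← ENNReal.ofReal_one, ← ENNReal.ofReal_sub _ h0.le,
    ← ENNReal.ofReal_inv_of_pos (by linarith), ← ENNReal.ofReal_mul ha.le]
  refine ENNReal.ofReal_le_ofReal ?_
  rw [← div_eq_mul_inv, one_le_div (by linarith)]
  exact h2

/-! ### Fractional energies on convex sets -/

section PairEnergy

variable {E : Type*} [NormedAddCommGroup E] [MeasurableSpace E]

/-- The set of pairs of points of `B` at distance less than `t`. -/
def closePairs (B : Set E) (t : ℝ) : Set (E × E) :=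
  {p | p.1 ∈ B ∧ p.2 ∈ B ∧ dist p.1 p.2 < t}

/-- The total oscillation `∫∫ |f x - f y|` of `f` over the pairs of points of `B` at distance less
than `t`. -/
noncomputable def pairEnergy (μ : Measure E) (f : E → ℝ) (B : Set E) (t : ℝ) : ℝ≥0∞ :=
  ∫⁻ p in closePairs B t, ENNReal.ofReal |f p.1 - f p.2| ∂(μ.prod μ)

/-- The Gagliardo-type energy `∫∫_{B × B} |f x - f y| / |x - y| ^ p`. -/
noncomputable def gagliardoEnergy (μ : Measure E) (f : E → ℝ) (B : Set E) (p : ℝ) : ℝ≥0∞ :=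
  ∫⁻ q in B ×ˢ B, ENNReal.ofReal (|f q.1 - f q.2| / dist q.1 q.2 ^ p) ∂(μ.prod μ)

variable [NormedSpace ℝ E] [BorelSpace E] [FiniteDimensional ℝ E]

lemma measurableSet_closePairs {B : Set E} (hB : MeasurableSet B) (t : ℝ) :
    MeasurableSet (closePairs B t) :=
  (measurable_fst hB).inter ((measurable_snd hB).inter
    (measurableSet_lt (measurable_fst.dist measurable_snd) measurable_const))

lemma lintegral_comp_midpoint (μ : Measure E) [μ.IsAddHaarMeasure] (G : E → ℝ≥0∞) (y : E) :
    ∫⁻ x, G (midpoint ℝ x y) ∂μ = 2 ^ Module.finrank ℝ E * ∫⁻ x, G x ∂μ := by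
  have h1 : ∀ x : E, midpoint ℝ x y = (2⁻¹ : ℝ) • (x + y) := by
    intro x; rw [midpoint_eq_smul_add, invOf_eq_inv]
  simp_rw [h1]
  rw [lintegral_add_right_eq_self (fun x => G ((2⁻¹ : ℝ) • x)) y,
    ← (measurableEmbedding_const_smul₀ (show (2⁻¹ : ℝ) ≠ 0 by norm_num)).lintegral_map,
    Measure.map_addHaar_smul μ (by norm_num), lintegral_smul_measure, smul_eq_mul]
  congr 1
  rw [inv_pow, inv_inv, abs_of_pos (by positivity), ENNReal.ofReal_pow (by norm_num)]
  norm_num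

/-- Two close points of a convex set are compared through their midpoint, which is twice as close
to either of them: halving the scale costs a factor `2 * 2 ^ d`. -/
lemma pairEnergy_le_half (μ : Measure E) [μ.IsAddHaarMeasure] {f : E → ℝ} (hf : Measurable f)
    {B : Set E} (hB : MeasurableSet B) (hc : Convex ℝ B) (t : ℝ) :
    pairEnergy μ f B t ≤ 2 ^ (Module.finrank ℝ E + 1) * pairEnergy μ f B (t / 2) := by
  have hmid : Measurable fun p : E × E => midpoint ℝ p.1 p.2 := by
    simp_rw [midpoint_eq_smul_add]; fun_prop
  have hS := measurableSet_closePairs hB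
  set A := ∫⁻ p in closePairs B t, ENNReal.ofReal |f (midpoint ℝ p.1 p.2) - f p.2| ∂(μ.prod μ)
    with hA
  have hswap : ∫⁻ p in closePairs B t, ENNReal.ofReal |f p.1 - f (midpoint ℝ p.1 p.2)|
      ∂(μ.prod μ) = A := by
    rw [hA, ← lintegral_indicator (hS t), ← lintegral_indicator (hS t), ← lintegral_prod_swap]
    refine lintegral_congr fun p => ?_
    have : p.swap ∈ closePairs B t ↔ p ∈ closePairs B t := by
      simp only [closePairs, mem_ofPred_eq, Prod.fst_swap, Prod.snd_swap, dist_comm p.2 p.1]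
      tauto
    by_cases hp : p ∈ closePairs B t
    · rw [indicator_of_mem hp, indicator_of_mem (this.2 hp), Prod.fst_swap, Prod.snd_swap,
        midpoint_comm, abs_sub_comm]
    · rw [indicator_of_notMem hp, indicator_of_notMem (this.not.2 hp)]
  have htri : pairEnergy μ f B t ≤ A + A := by
    nth_rewrite 1 [← hswap]
    rw [hA, ← lintegral_add_left (by fun_prop), pairEnergy]
    refine lintegral_mono fun p => ?_
    rw [← ENNReal.ofReal_add (abs_nonneg _) (abs_nonneg _)]
    exact ENNReal.ofReal_le_ofReal (abs_sub_le _ _ _)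
  have hsub : A ≤ 2 ^ Module.finrank ℝ E * pairEnergy μ f B (t / 2) := by
    set G : E × E → ℝ≥0∞ :=
      (closePairs B (t / 2)).indicator fun p => ENNReal.ofReal |f p.1 - f p.2| with hG
    have hGm : Measurable G := Measurable.indicator (by fun_prop) (hS _)
    calc A ≤ ∫⁻ p, G (midpoint ℝ p.1 p.2, p.2) ∂(μ.prod μ) := by
          rw [hA, ← lintegral_indicator (hS t)]
          refine lintegral_mono fun p => indicator_le
            (g := fun p : E × E => G (midpoint ℝ p.1 p.2, p.2)) (fun p hp => ?_) p
          have hmem : (midpoint ℝ p.1 p.2, p.2) ∈ closePairs B (t / 2) := by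
            refine ⟨hc.midpoint_mem hp.1 hp.2.1, hp.2.1, ?_⟩
            rw [dist_midpoint_right]
            have := hp.2.2
            norm_num
            linarith
          change _ ≤ G (midpoint ℝ p.1 p.2, p.2)
          rw [hG, indicator_of_mem hmem]
      _ = 2 ^ Module.finrank ℝ E * ∫⁻ p, G p ∂(μ.prod μ) := by
          have hGm' : Measurable fun p : E × E => G (midpoint ℝ p.1 p.2, p.2) :=
            hGm.comp (hmid.prodMk measurable_snd)
          rw [lintegral_prod_symm _ hGm'.aemeasurable,
            lintegral_prod_symm _ hGm.aemeasurable, ← lintegral_const_mul' _ _ (by simp)]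
          exact lintegral_congr fun y => lintegral_comp_midpoint μ (fun x => G (x, y)) y
      _ = _ := by rw [hG, lintegral_indicator (hS _), pairEnergy]
  calc pairEnergy μ f B t ≤ A + A := htri
    _ = 2 * A := (two_mul A).symm
    _ ≤ 2 * (2 ^ Module.finrank ℝ E * pairEnergy μ f B (t / 2)) := by gcongr
    _ = _ := by rw [pow_succ']; ring

lemma pairEnergy_le_dyadic (μ : Measure E) [μ.IsAddHaarMeasure] {f : E → ℝ} (hf : Measurable f)
    {B : Set E} (hB : MeasurableSet B) (hc : Convex ℝ B) (t : ℝ) (k : ℕ) :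
    pairEnergy μ f B t ≤ (2 ^ (Module.finrank ℝ E + 1)) ^ k * pairEnergy μ f B (t / 2 ^ k) := by
  induction k with
  | zero => simp
  | succ k ih =>
    refine ih.trans ?_
    rw [pow_succ _ k, mul_assoc]
    gcongr
    refine (pairEnergy_le_half μ hf hB hc _).trans_eq ?_
    rw [div_div, ← pow_succ]

/-- Bourgain–Brezis–Mironescu type bound with the sharp factor `1 - δ`: the oscillation at every
dyadic scale below `t` is controlled from below by the one at scale `t`, and these lower bounds
add up to a geometric series of ratio `2 ^ (δ - 1)`. -/
lemma pairEnergy_le_gagliardoEnergy (μ : Measure E) [μ.IsAddHaarMeasure] {f : E → ℝ}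
    (hf : Measurable f) {B : Set E} (hB : MeasurableSet B) (hc : Convex ℝ B) {t : ℝ} (ht : 0 < t)
    {d δ : ℝ} (hd : d = Module.finrank ℝ E) (hd1 : 1 ≤ d) (hδ0 : 0 < δ) (hδ1 : δ < 1) :
    ENNReal.ofReal (t ^ (-(d + δ))) * pairEnergy μ f B t ≤
      ENNReal.ofReal (2 * (1 - δ)) * gagliardoEnergy μ f B (d + δ) := by
  have hS := measurableSet_closePairs hB
  set a := ENNReal.ofReal (t ^ (-(d + δ))) with ha
  -- the weighted oscillations at the scales `t / 2 ^ k` sum up to at most twice the energy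
  have hsum : ∑' k : ℕ, ENNReal.ofReal ((t / 2 ^ k) ^ (-(d + δ))) * pairEnergy μ f B (t / 2 ^ k)
      ≤ 2 * gagliardoEnergy μ f B (d + δ) := by
    have e : ∀ k : ℕ, ENNReal.ofReal ((t / 2 ^ k) ^ (-(d + δ))) * pairEnergy μ f B (t / 2 ^ k) =
        ∫⁻ q in B ×ˢ B, (if dist q.1 q.2 < t / 2 ^ k then
          ENNReal.ofReal ((t / 2 ^ k) ^ (-(d + δ))) else 0) *
            ENNReal.ofReal |f q.1 - f q.2| ∂(μ.prod μ) := by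
      intro k
      rw [pairEnergy, ← lintegral_const_mul _ (by fun_prop), ← lintegral_indicator (hS _),
        ← lintegral_indicator (hB.prod hB)]
      refine lintegral_congr fun q => ?_
      by_cases hq : q ∈ B ×ˢ B
      · by_cases hq' : dist q.1 q.2 < t / 2 ^ k
        · have hq'' : q ∈ closePairs B (t / 2 ^ k) := ⟨hq.1, hq.2, hq'⟩
          rw [indicator_of_mem hq, if_pos hq', indicator_of_mem hq'']
        · have hq'' : q ∉ closePairs B (t / 2 ^ k) := fun h => hq' h.2.2
          rw [indicator_of_mem hq, if_neg hq', zero_mul, indicator_of_notMem hq'']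
      · rw [indicator_of_notMem hq, indicator_of_notMem fun h : q ∈ closePairs B _ =>
          hq ⟨h.1, h.2.1⟩]
    simp_rw [e]
    rw [← lintegral_tsum]
    · rw [gagliardoEnergy, ← lintegral_const_mul' _ _ (by simp)]
      refine lintegral_mono fun q => ?_
      rw [ENNReal.tsum_mul_right]
      rcases eq_or_ne q.1 q.2 with h | h
      · simp [h]
      · have hq := dist_pos.2 h
        refine (mul_le_mul_left (tsum_dyadic_ofReal_rpow_le (by linarith) hq ht) _).trans_eq ?_
        rw [← ENNReal.ofReal_mul (by positivity), Real.rpow_neg hq.le,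
          show (2 : ℝ≥0∞) = ENNReal.ofReal 2 by simp, ← ENNReal.ofReal_mul (by norm_num)]
        congr 1
        ring
    · intro k
      refine Measurable.aemeasurable (Measurable.mul (Measurable.ite ?_ measurable_const
        measurable_const) (by fun_prop))
      exact measurableSet_lt (measurable_fst.dist measurable_snd) measurable_const
  -- the oscillation at scale `t` controls each term from below
  have hterm : ∀ k : ℕ, a * pairEnergy μ f B t * ENNReal.ofReal (2 ^ (-(1 - δ))) ^ k ≤
      ENNReal.ofReal ((t / 2 ^ k) ^ (-(d + δ))) * pairEnergy μ f B (t / 2 ^ k) := by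
    intro k
    have h := pairEnergy_le_dyadic μ hf hB hc t k
    have e : ENNReal.ofReal ((t / 2 ^ k) ^ (-(d + δ))) =
        a * ENNReal.ofReal (2 ^ (-(1 - δ))) ^ k * (2 ^ (Module.finrank ℝ E + 1)) ^ k := by
      rw [ha, ← ENNReal.ofReal_pow (by positivity), show (2 : ℝ≥0∞) = ENNReal.ofReal 2 by simp,
        ← ENNReal.ofReal_pow (by positivity), ← ENNReal.ofReal_pow (by positivity),
        ← ENNReal.ofReal_mul (by positivity), ← ENNReal.ofReal_mul (by positivity),
        Real.div_rpow ht.le (by positivity)]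
      congr 1
      rw [Real.rpow_neg (by positivity : (0:ℝ) ≤ 2 ^ k), div_inv_eq_mul, mul_assoc, ← mul_pow,
        ← Real.rpow_natCast 2 (Module.finrank ℝ E + 1), ← Real.rpow_add (by norm_num),
        ← Real.rpow_natCast 2 k, ← Real.rpow_mul (by norm_num), ← Real.rpow_mul_natCast
        (by norm_num)]
      congr 2
      push_cast
      rw [← hd]
      ring
    rw [e]
    calc _ ≤ a * ((2 ^ (Module.finrank ℝ E + 1)) ^ k * pairEnergy μ f B (t / 2 ^ k)) *
          ENNReal.ofReal (2 ^ (-(1 - δ))) ^ k := by gcongr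
      _ = _ := by ring
  calc a * pairEnergy μ f B t
      ≤ a * pairEnergy μ f B t *
        (ENNReal.ofReal (1 - δ) * ∑' k : ℕ, ENNReal.ofReal (2 ^ (-(1 - δ))) ^ k) :=
        le_mul_of_one_le_right' (one_le_mul_tsum_geometric (by linarith))
    _ = ENNReal.ofReal (1 - δ) *
        ∑' k : ℕ, a * pairEnergy μ f B t * ENNReal.ofReal (2 ^ (-(1 - δ))) ^ k := by
        rw [ENNReal.tsum_mul_left]; ring
    _ ≤ ENNReal.ofReal (1 - δ) * (2 * gagliardoEnergy μ f B (d + δ)) := by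
        gcongr
        exact (ENNReal.tsum_le_tsum hterm).trans hsum
    _ = _ := by
        rw [ENNReal.ofReal_mul (by norm_num)]; simp; ring

/-- A set filling exactly half of a ball has large fractional energy there: of the pairs of points
of the ball, half are separated by the set. -/
lemma rpow_le_gagliardoEnergy_of_half (μ : Measure E) [μ.IsAddHaarMeasure] {U : Set E}
    (hU : MeasurableSet U) {z : E} {ρ : ℝ} (hρ : 0 < ρ)
    {d δ : ℝ} (hd : d = Module.finrank ℝ E) (hd1 : 1 ≤ d) (hδ0 : 0 < δ) (hδ1 : δ < 1)
    (hhalf : μ.real (U ∩ Metric.ball z ρ) = μ.real (Metric.ball z ρ) / 2) :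
    ENNReal.ofReal (ρ ^ (d - δ)) ≤
      ENNReal.ofReal (2 ^ (d + 4) / μ.real (Metric.ball 0 1) ^ 2 * (1 - δ)) *
        gagliardoEnergy μ (U.indicator fun _ => 1) (Metric.ball z ρ) (d + δ) := by
  set B := Metric.ball z ρ with hBdef
  set ω := μ.real (Metric.ball (0 : E) 1) with hω
  have hω0 : 0 < ω := ENNReal.toReal_pos (Metric.measure_ball_pos μ _ one_pos).ne'
    measure_ball_lt_top.ne
  have hBv : μ.real B = ρ ^ d * ω := by
    rw [hBdef, measureReal_def, Measure.addHaar_ball_of_pos μ z hρ, ENNReal.toReal_mul,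
      ENNReal.toReal_ofReal (by positivity), hd, Real.rpow_natCast, hω, measureReal_def]
  have hBfin : μ B ≠ ∞ := measure_ball_lt_top.ne
  have hB : MeasurableSet B := measurableSet_ball
  set f : E → ℝ := U.indicator fun _ => 1 with hf
  have hfm : Measurable f := measurable_const.indicator hU
  have hdiff : μ.real (B \ U) = μ.real B / 2 := by
    have := measureReal_sdiff_add_inter hU hBfin
    rw [inter_comm] at this
    linarith
  have hlow : ENNReal.ofReal (ω ^ 2 / 4 * ρ ^ (2 * d)) ≤ pairEnergy μ f B (2 * ρ) := by
    calc ENNReal.ofReal (ω ^ 2 / 4 * ρ ^ (2 * d))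
        = (μ.prod μ) ((U ∩ B) ×ˢ (B \ U)) := by
          rw [Measure.prod_prod,
            ← ofReal_measureReal (measure_ne_top_of_subset inter_subset_right hBfin),
            ← ofReal_measureReal (measure_ne_top_of_subset sdiff_subset hBfin),
            ← ENNReal.ofReal_mul (by positivity), hhalf, hdiff, hBv, two_mul, Real.rpow_add hρ]
          congr 1; ring
      _ = ∫⁻ p in (U ∩ B) ×ˢ (B \ U), ENNReal.ofReal |f p.1 - f p.2| ∂(μ.prod μ) := by
          rw [← setLIntegral_one]
          refine setLIntegral_congr_fun ((hU.inter hB).prod (hB.diff hU)) fun p hp => ?_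
          rw [hf, indicator_of_mem hp.1.1, indicator_of_notMem hp.2.2]
          simp
      _ ≤ _ := by
          refine lintegral_mono_set fun p hp => ⟨hp.1.2, hp.2.1, ?_⟩
          have h1 := Metric.mem_ball.1 hp.1.2
          have h2 := Metric.mem_ball.1 hp.2.1
          linarith [dist_triangle_right p.1 p.2 z]
  have hmain := pairEnergy_le_gagliardoEnergy μ hfm hB (convex_ball z ρ)
    (show 0 < 2 * ρ by positivity) hd hd1 hδ0 hδ1
  have hcmp : ρ ^ (d - δ) ≤ 2 ^ (d + 3) / ω ^ 2 *
      ((2 * ρ) ^ (-(d + δ)) * (ω ^ 2 / 4 * ρ ^ (2 * d))) := by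
    have e1 : ρ ^ (-(d + δ)) * ρ ^ (2 * d) = ρ ^ (d - δ) := by
      rw [← Real.rpow_add hρ]; congr 1; ring
    have e2 : (1 : ℝ) ≤ 2 ^ (d + 3) * 2 ^ (-(d + δ)) / 4 := by
      rw [← Real.rpow_add (by norm_num), le_div_iff₀ (by norm_num)]
      calc (1 : ℝ) * 4 = 2 ^ (2 : ℝ) := by norm_num
        _ ≤ _ := Real.rpow_le_rpow_of_exponent_le (by norm_num) (by linarith)
    calc ρ ^ (d - δ) ≤ (2 ^ (d + 3) * 2 ^ (-(d + δ)) / 4) * ρ ^ (d - δ) :=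
          le_mul_of_one_le_left (by positivity) e2
      _ = _ := by
          rw [Real.mul_rpow (by norm_num) hρ.le, ← e1]
          field_simp
  calc ENNReal.ofReal (ρ ^ (d - δ))
      ≤ ENNReal.ofReal (2 ^ (d + 3) / ω ^ 2) * (ENNReal.ofReal ((2 * ρ) ^ (-(d + δ))) *
        ENNReal.ofReal (ω ^ 2 / 4 * ρ ^ (2 * d))) := by
        rw [← ENNReal.ofReal_mul (by positivity), ← ENNReal.ofReal_mul (by positivity)]
        exact ENNReal.ofReal_le_ofReal hcmp
    _ ≤ ENNReal.ofReal (2 ^ (d + 3) / ω ^ 2) * (ENNReal.ofReal (2 * (1 - δ)) *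
        gagliardoEnergy μ f B (d + δ)) := by
        exact mul_le_mul_right ((mul_le_mul_right hlow _).trans hmain) _
    _ = _ := by
        rw [← mul_assoc, ← ENNReal.ofReal_mul (by positivity)]
        congr 2
        rw [show d + 4 = d + 3 + 1 by ring, Real.rpow_add_one (by norm_num)]
        ring

end PairEnergy

/-! ### Balls filled to one half -/

section HalfBalls

open Filter Topology Metric

variable {E : Type*} [NormedAddCommGroup E]

lemma infDist_frontier_pos {Ω : Set E} (ho : IsOpen Ω) (hne : (frontier Ω).Nonempty) {x : E}
    (hx : x ∈ Ω) : 0 < infDist x (frontier Ω) :=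
  (isClosed_frontier.notMem_iff_infDist_pos hne).1 fun h =>
    (disjoint_frontier_iff_isOpen.2 ho).le_bot ⟨h, hx⟩

/-- The points around which a set fills at least half of arbitrarily small balls. -/
def halfDensityPoints [MeasurableSpace E] (μ : Measure E) (V : Set E) : Set E :=
  {x | ∀ ε > 0, ∃ ρ, 0 < ρ ∧ ρ ≤ ε ∧ μ.real (ball x ρ) / 2 ≤ μ.real (V ∩ ball x ρ)}

lemma IsOpen.subset_halfDensityPoints [MeasurableSpace E] (μ : Measure E) {V : Set E}
    (hV : IsOpen V) : V ⊆ halfDensityPoints μ V := by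
  intro x hx ε hε
  obtain ⟨r, hr, hrV⟩ := Metric.isOpen_iff.1 hV x hx
  refine ⟨min r ε, lt_min hr hε, min_le_right _ _, ?_⟩
  rw [inter_eq_right.2 ((ball_subset_ball (min_le_left _ _)).trans hrV)]
  linarith [measureReal_nonneg (μ := μ) (s := ball x (min r ε))]

variable [NormedSpace ℝ E]

lemma ball_infDist_frontier_subset {Ω : Set E} (ho : IsOpen Ω) {x : E} (hx : x ∈ Ω) :
    ball x (infDist x (frontier Ω)) ⊆ Ω := by
  rcases le_or_gt (infDist x (frontier Ω)) 0 with h | hpos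
  · rw [ball_eq_empty.2 h]
    exact empty_subset _
  refine (convex_ball x _).isPreconnected.subset_of_closure_inter_subset ho
    ⟨x, mem_ball_self hpos, hx⟩ fun w hw => ?_
  by_contra hwΩ
  have hwf : w ∈ frontier Ω := by
    rw [ho.frontier_eq]
    exact ⟨hw.1, hwΩ⟩
  have h1 := infDist_le_dist_of_mem (x := x) hwf
  have h2 := mem_ball'.1 hw.2
  linarith

variable [MeasurableSpace E] [BorelSpace E] [FiniteDimensional ℝ E]

lemma continuousAt_measureReal_inter_ball (μ : Measure E) [μ.IsAddHaarMeasure] (U : Set E)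
    {p : E × ℝ} (hp : 0 < p.2) :
    ContinuousAt (fun q : E × ℝ => μ.real (U ∩ ball q.1 q.2)) p := by
  have e : (fun q : E × ℝ => μ.real (U ∩ ball q.1 q.2)) =
      fun q => ∫ y in U, (ball q.1 q.2).indicator (fun _ => (1 : ℝ)) y ∂μ := by
    ext q
    rw [integral_indicator_const _ measurableSet_ball, smul_eq_mul, mul_one,
      measureReal_restrict_apply measurableSet_ball, inter_comm]
  rw [e]
  refine continuousAt_of_dominated (bound := (ball p.1 (p.2 + 2)).indicator fun _ => (1 : ℝ))
    ?_ ?_ ?_ ?_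
  · exact Eventually.of_forall fun q =>
      (measurable_const.indicator measurableSet_ball).aestronglyMeasurable
  · have h1 : ∀ᶠ q : E × ℝ in 𝓝 p, dist q.1 p.1 < 1 :=
      (continuous_fst.continuousAt (x := p)).eventually (ball_mem_nhds _ one_pos)
    have h2 : ∀ᶠ q : E × ℝ in 𝓝 p, q.2 < p.2 + 1 :=
      (continuous_snd.continuousAt (x := p)).eventually (gt_mem_nhds (by linarith))
    filter_upwards [h1, h2] with q hq1 hq2
    refine Eventually.of_forall fun y => ?_
    rw [Real.norm_of_nonneg (indicator_nonneg (fun _ _ => zero_le_one) _)]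
    refine indicator_le_indicator_of_subset (ball_subset_ball' ?_) (fun _ => zero_le_one) y
    linarith
  · exact ((integrable_indicator_iff measurableSet_ball).2
      (integrableOn_const measure_ball_lt_top.ne)).mono_measure Measure.restrict_le_self
  · -- the indicator of the ball is locally constant in the ball off the limiting sphere
    have hs : ∀ᵐ y ∂μ, y ∉ sphere p.1 p.2 :=
      measure_eq_zero_iff_ae_notMem.1 (Measure.addHaar_sphere_of_ne_zero μ p.1 hp.ne')
    filter_upwards [ae_restrict_of_ae hs] with y hy
    have hc : Continuous fun q : E × ℝ => dist y q.1 - q.2 := by fun_prop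
    rcases lt_or_gt_of_ne (fun h => hy (mem_sphere.2 h) : dist y p.1 ≠ p.2) with h | h
    · have : ∀ᶠ q in 𝓝 p, dist y q.1 - q.2 < 0 :=
        hc.continuousAt.eventually (gt_mem_nhds (by linarith))
      refine (continuousAt_const (y := (1 : ℝ))).congr ?_
      filter_upwards [this] with q hq
      rw [indicator_of_mem (mem_ball.2 (by linarith))]
    · have : ∀ᶠ q in 𝓝 p, 0 < dist y q.1 - q.2 :=
        hc.continuousAt.eventually (lt_mem_nhds (by linarith))
      refine (continuousAt_const (y := (0 : ℝ))).congr ?_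
      filter_upwards [this] with q hq
      rw [indicator_of_notMem fun h' => by have := mem_ball.1 h'; linarith]

lemma measure_diff_halfDensityPoints (μ : Measure E) [μ.IsAddHaarMeasure] {V : Set E}
    (hV : MeasurableSet V) : μ (V \ halfDensityPoints μ V) = 0 := by
  have h := (ae_restrict_iff' hV).1 (Besicovitch.ae_tendsto_measure_inter_div μ V)
  rw [measure_eq_zero_iff_ae_notMem]
  filter_upwards [h] with x hx' hx
  refine hx.2 ?_
  intro ε hε
  have ht := hx' hx.1
  have h1 : ∀ᶠ r in 𝓝[>] (0 : ℝ), (1 / 2 : ℝ≥0∞) < μ (V ∩ closedBall x r) / μ (closedBall x r) :=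
    ht.eventually (lt_mem_nhds (by norm_num))
  have h2 : ∀ᶠ r in 𝓝[>] (0 : ℝ), r ∈ Ioo (0 : ℝ) ε := Ioo_mem_nhdsGT hε
  obtain ⟨ρ, hρ1, hρ0, hρε⟩ := (h1.and h2).exists
  refine ⟨ρ, hρ0, hρε.le, ?_⟩
  have hae : closedBall x ρ =ᵐ[μ] ball x ρ := by
    rw [← ball_union_sphere]
    exact union_ae_eq_left_of_ae_eq_empty
      (ae_eq_empty.2 (Measure.addHaar_sphere_of_ne_zero μ x hρ0.ne'))
  rw [measure_congr ((ae_eq_refl V).inter hae), measure_congr hae,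
    ENNReal.lt_div_iff_mul_lt (Or.inl (measure_ball_pos μ x hρ0).ne')
      (Or.inl measure_ball_lt_top.ne)] at hρ1
  have := ENNReal.toReal_mono
    (measure_ne_top_of_subset inter_subset_right measure_ball_lt_top.ne) hρ1.le
  rw [ENNReal.toReal_mul] at this
  simp only [measureReal_def]
  norm_num at this
  linarith

/-- Along a curve from `x` to a point `y` whose ball is filled at most by half, the balls of radius
comparable to the distance to the boundary, preceded if necessary by the smaller balls around `x`,
change their filling continuously, so that one of them is filled exactly by half. -/
lemma exists_half_ball (μ : Measure E) [μ.IsAddHaarMeasure] {V Ω : Set E} {s A κ : ℝ}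
    (hs : 0 < s) (hA : 0 < A) (hκ : 0 < κ)
    (hpos : ∀ z ∈ Ω, 0 < infDist z (frontier Ω)) {x y : E} {c : ℝ → E}
    (hc : ContinuousOn c (Icc 0 1)) (hcΩ : MapsTo c (Icc 0 1) Ω) (hc0 : c 0 = x) (hc1 : c 1 = y)
    (hcJ : ∀ t ∈ Icc (0 : ℝ) 1, dist (c t) x ^ s < A * infDist (c t) (frontier Ω))
    (hx : x ∈ halfDensityPoints μ V)
    (hy : μ.real (V ∩ ball y (κ * infDist y (frontier Ω))) ≤
      μ.real (ball y (κ * infDist y (frontier Ω))) / 2) :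
    ∃ z ∈ Ω, ∃ ρ, 0 < ρ ∧ ρ ≤ κ * infDist z (frontier Ω) ∧ dist z x ^ s < A / κ * ρ ∧
      μ.real (V ∩ ball z ρ) = μ.real (ball z ρ) / 2 := by
  set ψ : E × ℝ → ℝ := fun q => μ.real (V ∩ ball q.1 q.2) - μ.real (ball q.1 q.2) / 2 with hψ
  have hψc : ContinuousOn ψ {q | 0 < q.2} := fun q hq => by
    have h1 := continuousAt_measureReal_inter_ball μ V hq
    have h2 := continuousAt_measureReal_inter_ball μ univ hq
    simp only [univ_inter] at h2
    exact (h1.sub (h2.div_const 2)).continuousWithinAt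
  have h01 : (0 : ℝ) ∈ Icc (0 : ℝ) 1 := by simp
  have hxΩ : x ∈ Ω := hc0 ▸ hcΩ h01
  have hdx := hpos x hxΩ
  -- if the Whitney ball at `x` is filled at most by half, shrink it; otherwise move along `c`
  rcases le_total (ψ (x, κ * infDist x (frontier Ω))) 0 with h | h
  · obtain ⟨ρ₀, hρ₀, hρ₀', hhalf⟩ := hx (κ * infDist x (frontier Ω)) (by positivity)
    have hcont : ContinuousOn (fun ρ : ℝ => ψ (x, ρ)) (Icc ρ₀ (κ * infDist x (frontier Ω))) :=
      hψc.comp (by fun_prop) fun ρ hρ => hρ₀.trans_le hρ.1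
    obtain ⟨ρ, hρ, hρψ⟩ := intermediate_value_Icc' hρ₀' hcont
      (show (0 : ℝ) ∈ _ from ⟨h, by simp only [hψ]; linarith⟩)
    have hρ0 := hρ₀.trans_le hρ.1
    refine ⟨x, hxΩ, ρ, hρ0, hρ.2, ?_, by simp only [hψ] at hρψ; linarith⟩
    rw [dist_self, Real.zero_rpow hs.ne']
    positivity
  · have hcont : ContinuousOn (fun t : ℝ => ψ (c t, κ * infDist (c t) (frontier Ω))) (Icc 0 1) := by
      refine hψc.comp (hc.prodMk (continuousOn_const.mul
        ((continuous_infDist_pt _).comp_continuousOn hc))) fun t ht => ?_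
      exact mul_pos hκ (hpos _ (hcΩ ht))
    obtain ⟨t, ht, htψ⟩ := intermediate_value_Icc' zero_le_one hcont
      (show (0 : ℝ) ∈ _ from ⟨by simp only [hψ, hc1]; linarith, by simpa only [hc0] using h⟩)
    refine ⟨c t, hcΩ ht, κ * infDist (c t) (frontier Ω), mul_pos hκ (hpos _ (hcΩ ht)), le_rfl, ?_,
      by simp only [hψ] at htψ; linarith⟩
    refine (hcJ t ht).trans_eq ?_
    field_simp

end HalfBalls

/-! ### Local and global energies -/

section Perimeter

open Metric

variable {n : ℕ}

/-- The fractional energy in a small Whitney ball is a part of the improved perimeter, since there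
all pairs of points are close compared with their distance to the boundary. -/
lemma gagliardoEnergy_ball_le {δ τ : ℝ} (hτ0 : 0 < τ) (hτ1 : τ < 1)
    {V Ω : Set (EuclideanSpace ℝ (Fin n))} (hV : MeasurableSet V)
    {z : EuclideanSpace ℝ (Fin n)} {ρ : ℝ} (hρ0 : 0 < ρ)
    (hρ : ρ ≤ τ / 4 * infDist z (frontier Ω)) :
    gagliardoEnergy volume (V.indicator fun _ => 1) (ball z ρ) (n + δ) ≤
      ∫⁻ y in ball z ρ, ∫⁻ x in {x | dist x y < τ * infDist y (frontier Ω)},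
        ENNReal.ofReal (|V.indicator (fun _ => (1 : ℝ)) x - V.indicator (fun _ => (1 : ℝ)) y| /
          dist x y ^ ((n : ℝ) + δ)) := by
  have hm : Measurable (V.indicator fun _ => (1 : ℝ)) := measurable_const.indicator hV
  rw [gagliardoEnergy, setLIntegral_prod_symm _ (by fun_prop)]
  refine setLIntegral_mono' measurableSet_ball fun y hy => lintegral_mono_set fun x hx => ?_
  have hx' := mem_ball.1 hx
  have hy' := mem_ball.1 hy
  have h1 := dist_triangle_right x y z
  have h2 := infDist_le_infDist_add_dist (s := frontier Ω) (x := z) (y := y)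
  rw [dist_comm] at h2
  change dist x y < τ * infDist y (frontier Ω)
  have hd : 0 < infDist z (frontier Ω) := by
    by_contra h
    nlinarith
  nlinarith

lemma improvedPerimeter_diff_le {δ τ : ℝ} (hτ1 : τ < 1)
    {U Ω : Set (EuclideanSpace ℝ (Fin n))} (ho : IsOpen Ω) :
    improvedPerimeter δ τ (Ω \ U) Ω ≤ improvedPerimeter δ τ U Ω := by
  refine setLIntegral_mono' ho.measurableSet fun y hy => ?_
  refine setLIntegral_mono' (measurableSet_lt (by fun_prop) measurable_const) fun x hx => ?_
  have hx' : x ∈ Ω := by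
    refine ball_infDist_frontier_subset ho hy (mem_ball.2 (lt_of_lt_of_le hx ?_))
    exact mul_le_of_le_one_left infDist_nonneg hτ1.le
  by_cases h1 : x ∈ U <;> by_cases h2 : y ∈ U <;> simp [h1, h2, hx', hy]

lemma improvedPerimeter_congr_ae {δ τ : ℝ} {U V Ω : Set (EuclideanSpace ℝ (Fin n))}
    (h : U =ᵐ[volume] V) : improvedPerimeter δ τ U Ω = improvedPerimeter δ τ V Ω := by
  have hind : U.indicator (fun _ => (1 : ℝ)) =ᵐ[volume] V.indicator (fun _ => (1 : ℝ)) :=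
    indicator_ae_eq_of_ae_eq_set h
  refine lintegral_congr_ae ?_
  filter_upwards [ae_restrict_of_ae hind] with y hy
  refine lintegral_congr_ae ?_
  filter_upwards [ae_restrict_of_ae hind] with x hx
  rw [hx, hy]

/-- The energies in disjoint small Whitney balls add up to at most the improved perimeter. -/
lemma tsum_gagliardoEnergy_ball_le {δ τ : ℝ} (hτ0 : 0 < τ) (hτ1 : τ < 1)
    {V Ω : Set (EuclideanSpace ℝ (Fin n))} (hV : MeasurableSet V) (ho : IsOpen Ω)
    {u : Set (EuclideanSpace ℝ (Fin n) × ℝ)} (hu : u.Countable)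
    (hdisj : u.PairwiseDisjoint fun p => ball p.1 p.2)
    (hball : ∀ p ∈ u, p.1 ∈ Ω ∧ 0 < p.2 ∧ p.2 ≤ τ / 4 * infDist p.1 (frontier Ω)) :
    ∑' p : u, gagliardoEnergy volume (V.indicator fun _ => 1) (ball p.1.1 p.1.2) (n + δ) ≤
      improvedPerimeter δ τ V Ω := by
  have := hu.to_subtype
  refine (ENNReal.tsum_le_tsum fun p : u => gagliardoEnergy_ball_le hτ0 hτ1 hV
    (hball p p.2).2.1 (hball p p.2).2.2).trans ?_
  rw [← lintegral_iUnion (fun p : u => measurableSet_ball)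
    (fun p q hpq => hdisj p.2 q.2 (Subtype.coe_injective.ne hpq))]
  refine lintegral_mono_set (iUnion_subset fun p => ?_)
  obtain ⟨h1, h2, h3⟩ := hball p p.2
  refine (ball_subset_ball (h3.trans ?_)).trans (ball_infDist_frontier_subset ho h1)
  exact mul_le_of_le_one_left infDist_nonneg (by linarith)

/-! ### Covering of the density points -/

/-- A countable family of balls can be indexed by `ℕ` after adding balls of radius zero. -/
lemma exists_seq_of_countable {X : Type*} [PseudoMetricSpace X] [Nonempty X] {ι : Type*}
    {u : Set ι} (hu : u.Countable)
    (x : ι → X) (r : ι → ℝ) {R p : ℝ} (hR : 0 ≤ R) (hr : ∀ a ∈ u, 0 ≤ r a ∧ r a ≤ R) (hp : 0 < p) :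
    ∃ (x' : ℕ → X) (r' : ℕ → ℝ), (∀ i, 0 ≤ r' i ∧ r' i ≤ R) ∧
      (⋃ a ∈ u, ball (x a) (r a)) ⊆ ⋃ i, ball (x' i) (r' i) ∧
      ∑' i, ENNReal.ofReal (r' i ^ p) = ∑' a : u, ENNReal.ofReal (r a ^ p) := by
  obtain ⟨e, he⟩ := hu.to_subtype.exists_injective_nat
  let x₀ : X := Classical.arbitrary X
  refine ⟨Function.extend e (fun a : u => x a) fun _ => x₀,
    Function.extend e (fun a : u => r a) 0, fun i => ?_, ?_, ?_⟩
  · by_cases h : ∃ a, e a = i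
    · obtain ⟨a, rfl⟩ := h
      rw [he.extend_apply]
      exact hr a a.2
    · rw [Function.extend_apply' _ _ _ h]
      exact ⟨le_rfl, hR⟩
  · refine iUnion₂_subset fun a ha => ?_
    refine subset_iUnion_of_subset (e ⟨a, ha⟩) ?_
    rw [he.extend_apply, he.extend_apply]
  · rw [← he.tsum_eq]
    · simp_rw [he.extend_apply]
    · intro i hi
      by_contra h
      refine hi ?_
      beta_reduce
      rw [Function.extend_apply' _ _ _ h]
      simp [Real.zero_rpow hp.ne']

/-- The constant of the covering by enlarged half-filled balls: `4 ^ n (1 + K) ^ n` bounds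
`(4 (K ρ) ^ (1 / s)) ^ (s (n - δ)) / ρ ^ (n - δ)`, and the last factor comes from the energy of a
half-filled ball. -/
noncomputable def coveringConst (n : ℕ) (K : ℝ) : ℝ :=
  4 ^ n * (1 + K) ^ n *
    (2 ^ ((n : ℝ) + 4) / volume.real (ball (0 : EuclideanSpace ℝ (Fin n)) 1) ^ 2)

/-- If the set `V` fills at most half of the central Whitney ball of a John domain, then Vitali's
covering lemma, applied to the enlargements of the half-filled balls found along the John curves,
covers the density points of `V` with radii controlled by the improved perimeter. -/
lemma exists_covering_of_central_le_half (hn : 1 ≤ n) {δ τ s CJ D : ℝ}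
    (hδ0 : 0 < δ) (hδ1 : δ < 1) (hτ0 : 0 < τ) (hτ1 : τ < 1) (hs : 1 ≤ s) (hCJ : 1 ≤ CJ)
    (hsn : s * (n - δ) ≤ n) {Ω V : Set (EuclideanSpace ℝ (Fin n))} (ho : IsOpen Ω)
    (hpos : ∀ z ∈ Ω, 0 < infDist z (frontier Ω)) (hD : ∀ z ∈ Ω, infDist z (frontier Ω) ≤ D)
    (hD0 : 0 < D) {xJ : EuclideanSpace ℝ (Fin n)}
    (hJ : ∀ x ∈ Ω, ∃ c : ℝ → EuclideanSpace ℝ (Fin n), ContinuousOn c (Icc 0 1) ∧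
      MapsTo c (Icc 0 1) Ω ∧ c 0 = x ∧ c 1 = xJ ∧
      ∀ t ∈ Icc (0 : ℝ) 1, dist (c t) x ^ s < CJ * infDist (c t) (frontier Ω))
    (hV : MeasurableSet V) (hVΩ : V ⊆ Ω)
    (hcen : volume.real (V ∩ ball xJ (τ / 4 * infDist xJ (frontier Ω))) ≤
      volume.real (ball xJ (τ / 4 * infDist xJ (frontier Ω))) / 2)
    {K : ℝ} (hK : K = CJ / (τ / 4) + D ^ (s - 1)) :
    ∃ (x : ℕ → EuclideanSpace ℝ (Fin n)) (r : ℕ → ℝ),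
      (∀ i, 0 ≤ r i ∧ r i ≤ 4 * (1 + K * D)) ∧
      V ∩ halfDensityPoints volume V ⊆ ⋃ i, ball (x i) (r i) ∧
      ∑' i, ENNReal.ofReal (r i ^ (s * ((n : ℝ) - δ))) ≤
        ENNReal.ofReal (coveringConst n K * (1 - δ)) * improvedPerimeter δ τ V Ω := by
  have hn' : (1 : ℝ) ≤ n := by exact_mod_cast hn
  have hs0 : 0 < s := by linarith
  have hnδ : 0 < (n : ℝ) - δ := by linarith
  have hK1 : 0 < CJ / (τ / 4) := by positivity
  have hK2 : 0 < D ^ (s - 1) := by positivity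
  have hK0 : 0 < K := by linarith
  set R : EuclideanSpace ℝ (Fin n) × ℝ → ℝ := fun p => (K * p.2) ^ s⁻¹ with hR
  let T : Set (EuclideanSpace ℝ (Fin n) × ℝ) := {p | p.1 ∈ Ω ∧ 0 < p.2 ∧
    p.2 ≤ τ / 4 * infDist p.1 (frontier Ω) ∧
    volume.real (V ∩ ball p.1 p.2) = volume.real (ball p.1 p.2) / 2}
  have hTD : ∀ p ∈ T, p.2 ≤ D := fun p hp =>
    (hp.2.2.1.trans (mul_le_of_le_one_left infDist_nonneg (by linarith))).trans (hD _ hp.1)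
  have hRle : ∀ p ∈ T, R p ≤ 1 + K * D := fun p hp => by
    have hp0 := hp.2.1
    calc R p ≤ (1 + K * D) ^ s⁻¹ := by
          refine Real.rpow_le_rpow (by positivity) ?_ (by positivity)
          nlinarith [hTD p hp]
      _ ≤ (1 + K * D) ^ (1 : ℝ) :=
          Real.rpow_le_rpow_of_exponent_le (by linarith [mul_pos hK0 hD0])
            (inv_le_one_of_one_le₀ hs)
      _ = _ := Real.rpow_one _
  have hRpos : ∀ p ∈ T, 0 < R p := fun p hp => Real.rpow_pos_of_pos (mul_pos hK0 hp.2.1) _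
  -- the summand `D ^ (s - 1)` of `K` ensures that the enlarged ball contains the original one
  have hρR : ∀ p ∈ T, p.2 ≤ R p := fun p hp => by
    rw [hR, Real.le_rpow_inv_iff_of_pos hp.2.1.le (mul_pos hK0 hp.2.1).le hs0]
    calc p.2 ^ s = p.2 ^ (s - 1) * p.2 := by
          rw [← Real.rpow_add_one hp.2.1.ne']; ring_nf
      _ ≤ D ^ (s - 1) * p.2 := by
          have := Real.rpow_le_rpow hp.2.1.le (hTD p hp) (by linarith : 0 ≤ s - 1)
          have := hp.2.1
          gcongr
      _ ≤ K * p.2 := mul_le_mul_of_nonneg_right (by linarith) hp.2.1.le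
  obtain ⟨u, huT, hudisj, hucov⟩ := Vitali.exists_disjoint_subfamily_covering_enlargement_ball T
    (fun p => p.1) R (1 + K * D) hRle 4 (by norm_num)
  have hucount : u.Countable := hudisj.countable_of_isOpen (fun _ _ => isOpen_ball)
    fun p hp => nonempty_ball.2 (hRpos p (huT hp))
  obtain ⟨x, r, hr, hcov, hsum⟩ := exists_seq_of_countable hucount (fun p => p.1)
    (fun p => 4 * R p) (R := 4 * (1 + K * D)) (p := s * (n - δ)) (by positivity)
    (fun p hp => ⟨by linarith [hRpos p (huT hp)], by linarith [hRle p (huT hp)]⟩) (by positivity)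
  refine ⟨x, r, hr, fun y hy => hcov ?_, ?_⟩
  · obtain ⟨c, hc, hcΩ, hc0, hc1, hcJ⟩ := hJ y (hVΩ hy.1)
    obtain ⟨z, hz, ρ, hρ0, hρ, hzy, hhalf⟩ := exists_half_ball volume hs0 (by linarith)
      (show 0 < τ / 4 by linarith) hpos hc hcΩ hc0 hc1 hcJ hy.2 hcen
    obtain ⟨b, hb, hzb⟩ := hucov (z, ρ) ⟨hz, hρ0, hρ, hhalf⟩
    refine mem_iUnion₂.2 ⟨b, hb, hzb ?_⟩
    rw [mem_ball, dist_comm, hR, Real.lt_rpow_inv_iff_of_pos dist_nonneg (by positivity) hs0]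
    refine hzy.trans_le ?_
    gcongr
    linarith
  · rw [hsum]
    have hterm : ∀ p ∈ T, ENNReal.ofReal ((4 * R p) ^ (s * (n - δ))) ≤
        ENNReal.ofReal (coveringConst n K * (1 - δ)) *
          gagliardoEnergy volume (V.indicator fun _ => 1) (ball p.1 p.2) (n + δ) := by
      intro p hp
      have hp0 := hp.2.1
      have h1 : (4 * R p) ^ (s * (n - δ)) ≤ 4 ^ n * (1 + K) ^ n * p.2 ^ (n - δ) := by
        rw [Real.mul_rpow (by norm_num) (hRpos p hp).le, hR, ← Real.rpow_mul (by positivity),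
          inv_mul_cancel_left₀ hs0.ne', Real.mul_rpow hK0.le hp0.le, ← mul_assoc]
        gcongr
        · calc (4 : ℝ) ^ (s * (n - δ)) ≤ 4 ^ (n : ℝ) :=
                Real.rpow_le_rpow_of_exponent_le (by norm_num) hsn
            _ = 4 ^ n := Real.rpow_natCast _ _
        · calc K ^ (n - δ) ≤ (1 + K) ^ (n - δ) :=
                Real.rpow_le_rpow hK0.le (by linarith) hnδ.le
            _ ≤ (1 + K) ^ (n : ℝ) :=
                Real.rpow_le_rpow_of_exponent_le (by linarith) (by linarith)
            _ = (1 + K) ^ n := Real.rpow_natCast _ _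
      have h2 := rpow_le_gagliardoEnergy_of_half volume hV hp0 (d := n) (by simp) hn' hδ0 hδ1
        hp.2.2.2
      calc ENNReal.ofReal ((4 * R p) ^ (s * (n - δ)))
          ≤ ENNReal.ofReal (4 ^ n * (1 + K) ^ n) * ENNReal.ofReal (p.2 ^ (n - δ)) := by
            rw [← ENNReal.ofReal_mul (by positivity)]
            exact ENNReal.ofReal_le_ofReal h1
        _ ≤ ENNReal.ofReal (4 ^ n * (1 + K) ^ n) * (ENNReal.ofReal (2 ^ ((n : ℝ) + 4) /
            volume.real (ball (0 : EuclideanSpace ℝ (Fin n)) 1) ^ 2 * (1 - δ)) *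
            gagliardoEnergy volume (V.indicator fun _ => 1) (ball p.1 p.2) (n + δ)) :=
            mul_le_mul_right h2 _
        _ = _ := by
            rw [← mul_assoc, ← ENNReal.ofReal_mul (by positivity), coveringConst]
            congr 2
            ring
    calc ∑' p : u, ENNReal.ofReal ((4 * R p) ^ (s * (n - δ)))
        ≤ ∑' p : u, ENNReal.ofReal (coveringConst n K * (1 - δ)) *
          gagliardoEnergy volume (V.indicator fun _ => 1) (ball p.1.1 p.1.2) (n + δ) :=
          ENNReal.tsum_le_tsum fun p => hterm p (huT p.2)
      _ ≤ _ := by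
          rw [ENNReal.tsum_mul_left]
          refine mul_le_mul_right (tsum_gagliardoEnergy_ball_le hτ0 hτ1 hV ho hucount ?_ ?_) _
          · exact fun p hp q hq hpq => (hudisj hp hq hpq).mono
              (ball_subset_ball (hρR p (huT hp))) (ball_subset_ball (hρR q (huT hq)))
          · exact fun p hp => ⟨(huT hp).1, (huT hp).2.1, (huT hp).2.2.1⟩

end Perimeter

/-! ### The Boxing inequality -/

section Boxing

open Metric

variable {n : ℕ}

/-- A set covered by balls of radius at most `R` has measure controlled by the sum of the powers
`r i ^ p` with exponent `p ≤ n`. -/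
lemma measure_le_tsum_rpow_of_subset_iUnion_ball (hn : 1 ≤ n) {p R : ℝ} (hp : 0 < p)
    (hpn : p ≤ n) {V : Set (EuclideanSpace ℝ (Fin n))} {x : ℕ → EuclideanSpace ℝ (Fin n)}
    {r : ℕ → ℝ} (hr : ∀ i, 0 ≤ r i ∧ r i ≤ R) (hV : volume (V \ ⋃ i, ball (x i) (r i)) = 0) :
    volume V ≤ ENNReal.ofReal ((1 + R) ^ n) * volume (ball (0 : EuclideanSpace ℝ (Fin n)) 1) *
      ∑' i, ENNReal.ofReal (r i ^ p) := by
  have : Nonempty (Fin n) := ⟨⟨0, hn⟩⟩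
  have hR : 0 ≤ R := (hr 0).1.trans (hr 0).2
  calc volume V ≤ volume (⋃ i, ball (x i) (r i)) := by
        refine measure_mono_ae ?_
        rw [ae_le_set]
        exact hV
    _ ≤ ∑' i, volume (ball (x i) (r i)) := measure_iUnion_le _
    _ ≤ ∑' i, ENNReal.ofReal ((1 + R) ^ n) *
        volume (ball (0 : EuclideanSpace ℝ (Fin n)) 1) * ENNReal.ofReal (r i ^ p) := by
        refine ENNReal.tsum_le_tsum fun i => ?_
        rw [Measure.addHaar_ball _ _ (hr i).1, finrank_euclideanSpace_fin, mul_right_comm,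
          ← ENNReal.ofReal_mul (by positivity)]
        gcongr
        calc r i ^ n = r i ^ ((n - p) + p) := by rw [sub_add_cancel, Real.rpow_natCast]
          _ = r i ^ (n - p) * r i ^ p :=
              Real.rpow_add_of_nonneg (hr i).1 (by linarith) hp.le
          _ ≤ (1 + R) ^ n * r i ^ p := by
              refine mul_le_mul_of_nonneg_right ?_ (Real.rpow_nonneg (hr i).1 _)
              calc r i ^ (n - p) ≤ (1 + R) ^ (n - p) :=
                    Real.rpow_le_rpow (hr i).1 (by linarith [(hr i).2]) (by linarith)
                _ ≤ (1 + R) ^ (n : ℝ) :=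
                    Real.rpow_le_rpow_of_exponent_le (by linarith) (by linarith)
                _ = _ := Real.rpow_natCast _ _
    _ = _ := ENNReal.tsum_mul_left

/-- The distance of the John center to the boundary is bounded below in terms of the diameter. -/
lemma diam_rpow_lt_infDist_center {s CJ D : ℝ} (hs : 0 < s) {Ω : Set (EuclideanSpace ℝ (Fin n))}
    (hD0 : 0 < D) (hD : diam Ω = D) {xJ : EuclideanSpace ℝ (Fin n)}
    (hJ : ∀ x ∈ Ω, dist xJ x ^ s < CJ * infDist xJ (frontier Ω)) :
    (D / 3) ^ s < CJ * infDist xJ (frontier Ω) := by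
  by_contra h
  have hle : ∀ x ∈ Ω, dist xJ x ≤ D / 3 := fun x hx => by
    by_contra hx'
    have := Real.rpow_lt_rpow (by positivity) (not_le.1 hx') hs
    linarith [hJ x hx]
  have : diam Ω ≤ 2 * (D / 3) := by
    refine diam_le_of_forall_dist_le (by positivity) fun x hx y hy => ?_
    have := dist_triangle_left x y xJ
    linarith [hle x hx, hle y hy]
  linarith

/-- The constant of the covering by one large ball: `(1 + 2 D) ^ n` bounds the power of its radius,
and the quotient by which it is multiplied is the inverse of the lower bound for `1 - δ` times the
perimeter; the domain contains a ball of radius `(D / 3) ^ s / CJ`. -/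
noncomputable def oneBallConst (n : ℕ) (s γ CJ D K : ℝ) : ℝ :=
  (1 + 2 * D) ^ n * ((1 + 4 * (1 + K * D)) ^ n * coveringConst n K) /
    ((1 - γ) * ((D / 3) ^ s / CJ) ^ n)

lemma coveringConst_pos (n : ℕ) {K : ℝ} (hK : 0 < K) : 0 < coveringConst n K := by
  have : 0 < volume.real (ball (0 : EuclideanSpace ℝ (Fin n)) 1) :=
    ENNReal.toReal_pos (measure_ball_pos volume _ one_pos).ne' measure_ball_lt_top.ne
  rw [coveringConst]
  positivity

/-- If `U` fills more than half of the central ball, then the covering of `Ω \ U` bounds the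
perimeter from below by a constant, and one ball containing `Ω` covers `U`. -/
lemma two_mul_diam_rpow_le (hn : 1 ≤ n) {δ τ s γ CJ D K : ℝ} (hδ1 : δ < 1) (hτ1 : τ < 1)
    (hγ0 : 0 < γ) (hγ1 : γ < 1) (hs : 1 ≤ s) (hCJ : 1 ≤ CJ) (hsn : s * (n - δ) ≤ n)
    (hD0 : 0 < D) (hK : 0 < K) {Ω U : Set (EuclideanSpace ℝ (Fin n))} (ho : IsOpen Ω)
    (hfin : volume Ω ≠ ∞) (hU : MeasurableSet U) (hUΩ : U ⊆ Ω)
    (hUγ : volume U ≤ ENNReal.ofReal γ * volume Ω) {xJ : EuclideanSpace ℝ (Fin n)} (hxJ : xJ ∈ Ω)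
    (hcen : (D / 3) ^ s < CJ * infDist xJ (frontier Ω))
    {x : ℕ → EuclideanSpace ℝ (Fin n)} {r : ℕ → ℝ} (hr : ∀ i, 0 ≤ r i ∧ r i ≤ 4 * (1 + K * D))
    (hcov : (Ω \ U) ∩ halfDensityPoints volume (Ω \ U) ⊆ ⋃ i, ball (x i) (r i))
    (hsum : ∑' i, ENNReal.ofReal (r i ^ (s * ((n : ℝ) - δ))) ≤
        ENNReal.ofReal (coveringConst n K * (1 - δ)) * improvedPerimeter δ τ (Ω \ U) Ω) :
    ENNReal.ofReal ((2 * D) ^ (s * ((n : ℝ) - δ))) ≤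
      ENNReal.ofReal (oneBallConst n s γ CJ D K * (1 - δ)) * improvedPerimeter δ τ U Ω := by
  have hne : Nonempty (Fin n) := ⟨⟨0, hn⟩⟩
  have hn' : (1 : ℝ) ≤ n := by exact_mod_cast hn
  have hp : 0 < s * ((n : ℝ) - δ) := mul_pos (by linarith) (by linarith)
  have hV : MeasurableSet (Ω \ U) := ho.measurableSet.diff hU
  set ω := volume (ball (0 : EuclideanSpace ℝ (Fin n)) 1) with hω
  have hω0 : ω ≠ 0 := (measure_ball_pos volume _ one_pos).ne'
  have hωfin : ω ≠ ∞ := measure_ball_lt_top.ne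
  have hc := coveringConst_pos n hK
  set q := (D / 3) ^ s / CJ with hq
  have hq0 : 0 < q := by positivity
  set A := (1 + 4 * (1 + K * D)) ^ n with hA
  have hA0 : 0 < A := by positivity
  have hball : ENNReal.ofReal (q ^ n) * ω ≤ volume Ω := by
    have h1 : ball xJ q ⊆ Ω := by
      refine (ball_subset_ball ?_).trans (ball_infDist_frontier_subset ho hxJ)
      rw [hq, div_le_iff₀ (by linarith), mul_comm]
      exact hcen.le
    have h2 := measure_mono (μ := volume) h1
    rwa [Measure.addHaar_ball _ _ hq0.le, finrank_euclideanSpace_fin] at h2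
  have hlow : ENNReal.ofReal (1 - γ) * volume Ω ≤ volume (Ω \ U) := by
    rw [measure_sdiff hUΩ hU.nullMeasurableSet (measure_ne_top_of_subset hUΩ hfin),
      ENNReal.ofReal_sub _ hγ0.le, ENNReal.ofReal_one, ENNReal.sub_mul (fun _ _ => hfin), one_mul]
    exact tsub_le_tsub_left hUγ _
  have hup := measure_le_tsum_rpow_of_subset_iUnion_ball hn hp hsn hr (V := Ω \ U) <|
    measure_mono_null (fun y hy => (⟨hy.1, fun h => hy.2 (hcov ⟨hy.1, h⟩)⟩ :
      y ∈ (Ω \ U) \ halfDensityPoints volume (Ω \ U))) (measure_diff_halfDensityPoints volume hV)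
  set P := improvedPerimeter δ τ U Ω with hP
  have hmain : ENNReal.ofReal ((1 - γ) * q ^ n) ≤
      ENNReal.ofReal (A * (coveringConst n K * (1 - δ))) * P := by
    refine (ENNReal.mul_le_mul_iff_left hω0 hωfin).1 ?_
    calc ENNReal.ofReal ((1 - γ) * q ^ n) * ω
        = ENNReal.ofReal (1 - γ) * (ENNReal.ofReal (q ^ n) * ω) := by
          rw [ENNReal.ofReal_mul (by linarith), mul_assoc]
      _ ≤ ENNReal.ofReal (1 - γ) * volume Ω := mul_le_mul_right hball _
      _ ≤ volume (Ω \ U) := hlow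
      _ ≤ _ := hup
      _ ≤ ENNReal.ofReal A * ω * (ENNReal.ofReal (coveringConst n K * (1 - δ)) * P) :=
          mul_le_mul_right (hsum.trans (mul_le_mul_right (improvedPerimeter_diff_le hτ1 ho) _)) _
      _ = _ := by
          rw [ENNReal.ofReal_mul hA0.le]
          ring
  have hpow : (2 * D) ^ (s * ((n : ℝ) - δ)) ≤ (1 + 2 * D) ^ n := by
    calc (2 * D) ^ (s * ((n : ℝ) - δ)) ≤ (1 + 2 * D) ^ (s * ((n : ℝ) - δ)) :=
          Real.rpow_le_rpow (by positivity) (by linarith) hp.le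
      _ ≤ (1 + 2 * D) ^ (n : ℝ) := Real.rpow_le_rpow_of_exponent_le (by linarith) hsn
      _ = _ := Real.rpow_natCast _ _
  have hγ' : 0 < 1 - γ := by linarith
  calc ENNReal.ofReal ((2 * D) ^ (s * ((n : ℝ) - δ)))
      ≤ ENNReal.ofReal ((1 + 2 * D) ^ n / ((1 - γ) * q ^ n)) *
        ENNReal.ofReal ((1 - γ) * q ^ n) := by
        rw [← ENNReal.ofReal_mul (by positivity), div_mul_cancel₀ _ (by positivity)]
        exact ENNReal.ofReal_le_ofReal hpow
    _ ≤ ENNReal.ofReal ((1 + 2 * D) ^ n / ((1 - γ) * q ^ n)) *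
        (ENNReal.ofReal (A * (coveringConst n K * (1 - δ))) * P) := mul_le_mul_right hmain _
    _ = _ := by
        rw [← mul_assoc, ← ENNReal.ofReal_mul (by positivity), oneBallConst]
        congr 2
        ring

/-- The Boxing inequality for measurable sets, where the exceptional null set consists of the
points that are not density points. -/
lemma exists_covering_of_measurableSet (hn : 1 ≤ n) {δ τ s γ CJ D K : ℝ}
    (hδ0 : 0 < δ) (hδ1 : δ < 1) (hτ0 : 0 < τ) (hτ1 : τ < 1) (hγ0 : 0 < γ) (hγ1 : γ < 1)
    (hs : 1 ≤ s) (hCJ : 1 ≤ CJ) (hsn : s * (n - δ) ≤ n) (hD0 : 0 < D)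
    (hK : K = CJ / (τ / 4) + D ^ (s - 1)) {Ω U : Set (EuclideanSpace ℝ (Fin n))}
    (hΩ : IsDistanceJohnDomain s CJ Ω) (hD : diam Ω = D) (hU : MeasurableSet U) (hUΩ : U ⊆ Ω)
    (hUγ : volume U ≤ ENNReal.ofReal γ * volume Ω) :
    ∃ (x : ℕ → EuclideanSpace ℝ (Fin n)) (r : ℕ → ℝ), (∀ i, 0 ≤ r i) ∧
      U ∩ halfDensityPoints volume U ⊆ ⋃ i, ball (x i) (r i) ∧
      ∑' i, ENNReal.ofReal (r i ^ (s * ((n : ℝ) - δ))) ≤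
        ENNReal.ofReal ((coveringConst n K + oneBallConst n s γ CJ D K) * (1 - δ)) *
          improvedPerimeter δ τ U Ω := by
  have hne : Nonempty (Fin n) := ⟨⟨0, hn⟩⟩
  have hn' : (1 : ℝ) ≤ n := by exact_mod_cast hn
  have hK0 : 0 < K := by rw [hK]; positivity
  have hγ' : 0 < 1 - γ := by linarith
  have hc := coveringConst_pos n hK0
  have hc' : 0 ≤ oneBallConst n s γ CJ D K := by rw [oneBallConst]; positivity
  have hp : 0 < s * ((n : ℝ) - δ) := mul_pos (by linarith) (by linarith)
  have ho := hΩ.isOpen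
  have hfr : (frontier Ω).Nonempty := nonempty_frontier_iff.2 ⟨hΩ.isConnected.nonempty, fun h =>
    NormedSpace.unbounded_univ ℝ (EuclideanSpace ℝ (Fin n)) (h ▸ hΩ.isBounded)⟩
  have hpos : ∀ z ∈ Ω, 0 < infDist z (frontier Ω) := fun z hz => infDist_frontier_pos ho hfr hz
  have hle : ∀ z ∈ Ω, infDist z (frontier Ω) ≤ D := fun z hz => by
    obtain ⟨w, hw⟩ := hfr
    rw [← hD, ← diam_closure]
    exact (infDist_le_dist_of_mem hw).trans (dist_le_diam_of_mem hΩ.isBounded.closure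
      (subset_closure hz) (frontier_subset_closure hw))
  obtain ⟨xJ, hxJ, hJ⟩ := hΩ.exists_center
  have hJ' : ∀ x ∈ Ω, ∃ c : ℝ → EuclideanSpace ℝ (Fin n), ContinuousOn c (Icc 0 1) ∧
      MapsTo c (Icc 0 1) Ω ∧ c 0 = x ∧ c 1 = xJ ∧
      ∀ t ∈ Icc (0 : ℝ) 1, dist (c t) x ^ s < CJ * infDist (c t) (frontier Ω) := fun x hx => by
    obtain ⟨c, h1, -, h3, h4, h5, h6⟩ := hJ x hx
    exact ⟨c, h1, h3, h4, h5, h6⟩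
  set B := ball xJ (τ / 4 * infDist xJ (frontier Ω)) with hB
  have hBΩ : B ⊆ Ω := (ball_subset_ball (mul_le_of_le_one_left infDist_nonneg (by linarith))).trans
    (ball_infDist_frontier_subset ho hxJ)
  have hBfin : volume B ≠ ∞ := measure_ball_lt_top.ne
  rcases le_total (volume.real (U ∩ B)) (volume.real B / 2) with h | h
  · obtain ⟨x, r, hr, hcov, hsum⟩ := exists_covering_of_central_le_half hn hδ0 hδ1 hτ0 hτ1 hs hCJ
      hsn ho hpos hle hD0 hJ' hU hUΩ h hK
    refine ⟨x, r, fun i => (hr i).1, hcov, hsum.trans ?_⟩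
    gcongr
    linarith
  · have hV : MeasurableSet (Ω \ U) := ho.measurableSet.diff hU
    have h' : volume.real ((Ω \ U) ∩ B) ≤ volume.real B / 2 := by
      have e : (Ω \ U) ∩ B = B \ U := by
        ext y
        exact ⟨fun hy => ⟨hy.2, hy.1.2⟩, fun hy => ⟨⟨hBΩ hy.1, hy.2⟩, hy.1⟩⟩
      have := measureReal_sdiff_add_inter hU hBfin
      rw [inter_comm] at this
      rw [e]
      linarith
    obtain ⟨x, r, hr, hcov, hsum⟩ := exists_covering_of_central_le_half hn hδ0 hδ1 hτ0 hτ1 hs hCJ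
      hsn ho hpos hle hD0 hJ' hV sdiff_subset h' hK
    have hcen := diam_rpow_lt_infDist_center (CJ := CJ) (zero_lt_one.trans_le hs) hD0 hD
      (xJ := xJ) fun x hx => by
        obtain ⟨c, -, -, -, h1, h2⟩ := hJ' x hx
        simpa only [h1] using h2 1 (by simp)
    have hone := two_mul_diam_rpow_le hn hδ1 hτ1 hγ0 hγ1 hs hCJ hsn hD0 hK0 ho
      hΩ.isBounded.measure_lt_top.ne hU hUΩ hUγ hxJ hcen hr hcov hsum
    refine ⟨fun _ => xJ, fun i => if i = 0 then 2 * D else 0, fun i => ?_, fun y hy => ?_, ?_⟩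
    · dsimp only
      split_ifs <;> positivity
    · refine mem_iUnion.2 ⟨0, ?_⟩
      have := dist_le_diam_of_mem hΩ.isBounded (hUΩ hy.1) hxJ
      beta_reduce
      rw [if_pos rfl, mem_ball]
      linarith
    · beta_reduce
      rw [tsum_eq_single 0 fun i hi => by
        rw [if_neg hi, Real.zero_rpow hp.ne', ENNReal.ofReal_zero], if_pos rfl]
      refine hone.trans ?_
      gcongr
      linarith

lemma IsDistanceJohnDomain.diam_pos (hn : 1 ≤ n) {s CJ : ℝ}
    {Ω : Set (EuclideanSpace ℝ (Fin n))} (hΩ : IsDistanceJohnDomain s CJ Ω) : 0 < diam Ω := by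
  have hne : Nonempty (Fin n) := ⟨⟨0, hn⟩⟩
  obtain ⟨x, hx⟩ := hΩ.isConnected.nonempty
  exact Metric.diam_pos ((infinite_of_mem_nhds x (hΩ.isOpen.mem_nhds hx)).nontrivial) hΩ.isBounded

end Boxing

theorem mainTheorem2 (n : ℕ) (hn : 2 ≤ n) (τ γ s CJ D : ℝ)
    (hτ : τ ∈ Set.Ioo (0 : ℝ) 1) (hγ : γ ∈ Set.Ioo (0 : ℝ) 1) (hs : 1 ≤ s) (hCJ : 1 ≤ CJ) :
    ∃ C : ℝ, 0 < C ∧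
      ∀ δ ∈ Set.Ioo (0 : ℝ) 1, s ≤ (n : ℝ) / ((n : ℝ) - δ) →
      ∀ Ω : Set (EuclideanSpace ℝ (Fin n)), IsDistanceJohnDomain s CJ Ω → Metric.diam Ω = D →
      ∀ U : Set (EuclideanSpace ℝ (Fin n)), NullMeasurableSet U volume → U ⊆ Ω →
        volume U / volume Ω ≤ ENNReal.ofReal γ →
        ∃ N : Set (EuclideanSpace ℝ (Fin n)), volume N = 0 ∧ (IsOpen U → N = ∅) ∧
          ∃ (x : ℕ → EuclideanSpace ℝ (Fin n)) (r : ℕ → ℝ), (∀ i, 0 ≤ r i) ∧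
            U \ N ⊆ ⋃ i, Metric.ball (x i) (r i) ∧
            ∑' i, ENNReal.ofReal (r i ^ (s * ((n : ℝ) - δ))) ≤
              ENNReal.ofReal (C * (1 - δ)) * improvedPerimeter δ τ U Ω := by
  have hn' : (2 : ℝ) ≤ n := by exact_mod_cast hn
  -- a domain of dimension at least one has positive diameter, so other values of `D` are vacuous
  rcases le_or_gt D 0 with hD0 | hD0
  · refine ⟨1, one_pos, fun δ _ _ Ω hΩ hD => ?_⟩
    exact absurd (hΩ.diam_pos (by omega)) (by rw [hD]; exact not_lt.2 hD0)
  set K : ℝ := CJ / (τ / 4) + D ^ (s - 1) with hK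
  have hτ4 : 0 < τ / 4 := by linarith [hτ.1]
  have hK0 : 0 < K := by positivity
  have hγ' : 0 < 1 - γ := by linarith [hγ.2]
  refine ⟨coveringConst n K + oneBallConst n s γ CJ D K, ?_, ?_⟩
  · have hc := coveringConst_pos n hK0
    rw [oneBallConst]
    positivity
  intro δ hδ hsδ Ω hΩ hD U hU hUΩ hUγ
  have hsn : s * (n - δ) ≤ n := (le_div_iff₀ (by linarith [hδ.2])).1 hsδ
  have hΩ0 : volume Ω ≠ 0 := (hΩ.isOpen.measure_pos volume hΩ.isConnected.nonempty).ne'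
  have hΩfin : volume Ω ≠ ∞ := hΩ.isBounded.measure_lt_top.ne
  rw [ENNReal.div_le_iff hΩ0 hΩfin] at hUγ
  by_cases hUo : IsOpen U
  · obtain ⟨x, r, hr, hcov, hsum⟩ := exists_covering_of_measurableSet (by omega) hδ.1 hδ.2 hτ.1
      hτ.2 hγ.1 hγ.2 hs hCJ hsn hD0 hK hΩ hD hUo.measurableSet hUΩ hUγ
    refine ⟨∅, measure_empty, fun _ => rfl, x, r, hr, fun y hy => hcov ?_, hsum⟩
    exact ⟨hy.1, hUo.subset_halfDensityPoints volume hy.1⟩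
  · obtain ⟨V, hVU, hV, hae⟩ := hU.exists_measurable_subset_ae_eq
    obtain ⟨x, r, hr, hcov, hsum⟩ := exists_covering_of_measurableSet (by omega) hδ.1 hδ.2 hτ.1
      hτ.2 hγ.1 hγ.2 hs hCJ hsn hD0 hK hΩ hD hV (hVU.trans hUΩ) ((measure_mono hVU).trans hUγ)
    refine ⟨(U \ V) ∪ (V \ halfDensityPoints volume V), measure_union_null (ae_le_set.1 hae.symm.le)
      (measure_diff_halfDensityPoints volume hV), fun h => absurd h hUo, x, r, hr,
      fun y hy => hcov ?_, ?_⟩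
    · have hyV : y ∈ V := by_contra fun h => hy.2 (Or.inl ⟨hy.1, h⟩)
      exact ⟨hyV, by_contra fun h => hy.2 (Or.inr ⟨hyV, h⟩)⟩
    · rwa [improvedPerimeter_congr_ae hae] at hsum
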